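/- Let $n\ge 0$ and let $f,g:(\mathbb{R}^n,0)\to(\mathbb{R},0)$ be germs of real analytic functions (so $f(0)=g(0)=0$). Let $\mathcal{O}_n$ be the ring of germs at $0$ of real analytic functions $(\mathbb{R}^n,0)\to\mathbb{R}$ (with arbitrary value at $0$), and let $\mathcal{J}_f\subset\mathcal{O}_n$ be the Jacobi ideal of $f$, i.e. the ideal generated by $\frac{\partial f}{\partial x_1},\dots,\frac{\partial f}{\partial x_n}$. For an analytic germ $h:(\mathbb{R}^n,0)\to(\mathbb{R},0)$ let $S(h)$ be the set of all real $\eta>0$ for which there are a constant $C>0$ and a neighbourhood $U$ of $0$ with $$|\nabla h(x)|\ge C|h(x)|^{\eta}\quad\text{for all } x\in U,$$ where $|\nabla h(x)|$ is the Euclidean norm. Let $\varrho_0(h)=\inf S(h)\in[0,+\infty]$ be the Łojasiewicz exponent of $h$ in the gradient inequality, with the convention $\inf\emptyset=+\infty$. If $\nabla f(0)=0$ and $g-f\in\mathcal{J}_f^{3}$, then $\varrho_0(f)=\varrho_0(g)$. Moreover, a real number $\varrho$ is the smallest element of $S(f)$ if and only if it is the smallest element of $S(g)$. -/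

import Mathlib

open Filter Topology

noncomputable section

/-- The ring of germs at `0` of real analytic functions `(ℝⁿ, 0) → ℝ`,
as a subring of the ring of all germs at `0` of functions `ℝⁿ → ℝ`. -/
def AnalyticGerms (n : ℕ) : Subring (Germ (𝓝 (0 : EuclideanSpace ℝ (Fin n))) ℝ) where
  carrier := {φ | ∃ f : EuclideanSpace ℝ (Fin n) → ℝ, AnalyticAt ℝ f 0 ∧ (f : Germ _ ℝ) = φ}
  mul_mem' := by
    rintro _ _ ⟨f, hf, rfl⟩ ⟨g, hg, rfl⟩
    exact ⟨f * g, hf.mul hg, rfl⟩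
  one_mem' := ⟨fun _ => 1, analyticAt_const, rfl⟩
  add_mem' := by
    rintro _ _ ⟨f, hf, rfl⟩ ⟨g, hg, rfl⟩
    exact ⟨f + g, hf.add hg, rfl⟩
  zero_mem' := ⟨fun _ => 0, analyticAt_const, rfl⟩
  neg_mem' := by
    rintro _ ⟨f, hf, rfl⟩
    exact ⟨-f, hf.neg, rfl⟩

/-- The germ at `0` of a function that is analytic at `0`. -/
def analyticGerm {n : ℕ} (f : EuclideanSpace ℝ (Fin n) → ℝ) (hf : AnalyticAt ℝ f 0) :
    AnalyticGerms n :=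
  ⟨(f : Germ _ ℝ), f, hf, rfl⟩

/-- The partial derivative `∂f/∂xᵢ`. -/
def partialDeriv {n : ℕ} (i : Fin n) (f : EuclideanSpace ℝ (Fin n) → ℝ) :
    EuclideanSpace ℝ (Fin n) → ℝ :=
  fun x => fderiv ℝ f x (EuclideanSpace.single i 1)

theorem analyticAt_partialDeriv {n : ℕ} (i : Fin n) {f : EuclideanSpace ℝ (Fin n) → ℝ}
    (hf : AnalyticAt ℝ f 0) : AnalyticAt ℝ (partialDeriv i f) 0 :=
  ((ContinuousLinearMap.apply ℝ ℝ (EuclideanSpace.single i (1 : ℝ))).analyticAt _).comp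
    hf.fderiv

/-- The Jacobi ideal of `f`: the ideal generated by `∂f/∂x₁, …, ∂f/∂xₙ`
in the ring of germs of analytic functions. -/
def jacobiIdeal {n : ℕ} (f : EuclideanSpace ℝ (Fin n) → ℝ) (hf : AnalyticAt ℝ f 0) :
    Ideal (AnalyticGerms n) :=
  Ideal.span (Set.range fun i : Fin n =>
    analyticGerm (partialDeriv i f) (analyticAt_partialDeriv i hf))

/-- The exponents `η > 0` for which the Łojasiewicz gradient inequality
`|∇f(x)| ≥ C |f(x)|^η` holds in a neighbourhood of `0` with some constant `C > 0`. -/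
def lojasiewiczGradientExponents {n : ℕ} (f : EuclideanSpace ℝ (Fin n) → ℝ) : Set ℝ :=
  {η | 0 < η ∧ ∃ C : ℝ, 0 < C ∧
    ∀ᶠ x in 𝓝 (0 : EuclideanSpace ℝ (Fin n)), C * |f x| ^ η ≤ ‖gradient f x‖}

/-- The Łojasiewicz exponent in the gradient inequality, as the infimum in the extended
reals of the admissible exponents. -/
def lojasiewiczGradientExponent {n : ℕ} (f : EuclideanSpace ℝ (Fin n) → ℝ) : EReal :=
  sInf ((fun η : ℝ => (η : EReal)) '' lojasiewiczGradientExponents f)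

end

open Asymptotics

variable {n : ℕ}

/-! Membership in the cube of the Jacobi ideal gives g - f = O(|∇f|³) and, by Leibniz, ∇(g - f) =
O(|∇f|²) = o(|∇f|) (`isBigO_of_mem_jacobiIdeal_pow`). Hence |∇f| and |∇g| are comparable near 0. For
η in S(f), |g|^η is bounded by a multiple of |f|^η + |∇f|^(3η), and the last term is absorbed by
|∇f| once 3η ≥ 1. This holds because η ≥ 1/2 for a nonzero germ
(`half_le_of_mem_lojasiewiczGradientExponents`): f has exact order k along some line, while |∇f| =
O(|x|^(k/2)). So S(f) ⊆ S(g), and comparability lets f and g be exchanged. -/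

theorem norm_gradient_eq (f : EuclideanSpace ℝ (Fin n) → ℝ) (x : EuclideanSpace ℝ (Fin n)) :
    ‖gradient f x‖ = ‖fderiv ℝ f x‖ := by
  simp [gradient]

/-! ### Growth of powers of the Jacobi ideal -/

/-- The germs `φ` with `φ = O(‖Df‖ ^ (m + 1))` and `Dφ = O(‖Df‖ ^ m)`. -/
def gradientOrderIdeal (f : EuclideanSpace ℝ (Fin n) → ℝ) (hf : AnalyticAt ℝ f 0) (m : ℕ) :
    Ideal (AnalyticGerms n) where
  carrier := {φ | ∃ h : EuclideanSpace ℝ (Fin n) → ℝ, AnalyticAt ℝ h 0 ∧ (h : Germ _ ℝ) = φ.1 ∧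
    h =O[𝓝 0] (fun x => ‖fderiv ℝ f x‖ ^ (m + 1)) ∧
    fderiv ℝ h =O[𝓝 0] (fun x => ‖fderiv ℝ f x‖ ^ m)}
  zero_mem' := ⟨0, analyticAt_const, rfl, isBigO_zero _ _, by
    rw [fderiv_zero]; exact isBigO_zero _ _⟩
  add_mem' := by
    rintro a b ⟨h, hh, e, h1, h2⟩ ⟨k, hk, e', k1, k2⟩
    refine ⟨h + k, hh.add hk, ?_, h1.add k1, (h2.add k2).congr' ?_ EventuallyEq.rfl⟩
    · rw [Germ.coe_add, e, e']; rfl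
    · filter_upwards [hh.eventually_analyticAt, hk.eventually_analyticAt] with x hx kx
      exact (fderiv_add hx.differentiableAt kx.differentiableAt).symm
  smul_mem' := by
    rintro ⟨_, a, ha, rfl⟩ b ⟨k, hk, e', k1, k2⟩
    have ha1 : a =O[𝓝 0] (fun _ => (1 : ℝ)) := ha.continuousAt.isBigO_one ℝ
    have ha2 : fderiv ℝ a =O[𝓝 0] (fun _ => (1 : ℝ)) := ha.fderiv.continuousAt.isBigO_one ℝ
    have hf2 : (fun x => ‖fderiv ℝ f x‖) =O[𝓝 0] (fun _ => (1 : ℝ)) :=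
      (hf.fderiv.continuousAt.isBigO_one ℝ).norm_left
    refine ⟨a * k, ha.mul hk, ?_, (ha1.mul k1).congr_right fun x => by ring, ?_⟩
    · rw [Germ.coe_mul, e']; rfl
    · have k1' : k =O[𝓝 0] (fun x => ‖fderiv ℝ f x‖ ^ m) :=
        k1.trans (by simpa [pow_succ] using (isBigO_refl (fun x => ‖fderiv ℝ f x‖ ^ m) _).mul hf2)
      have h1 : (fun x => a x • fderiv ℝ k x) =O[𝓝 0] (fun x => ‖fderiv ℝ f x‖ ^ m) :=
        (ha1.smul k2).congr_right fun x => by simp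
      have h2 : (fun x => k x • fderiv ℝ a x) =O[𝓝 0] (fun x => ‖fderiv ℝ f x‖ ^ m) :=
        (k1'.smul ha2).congr_right fun x => by simp
      refine (h1.add h2).congr' ?_ EventuallyEq.rfl
      filter_upwards [ha.eventually_analyticAt, hk.eventually_analyticAt] with x hx kx
      exact (fderiv_mul hx.differentiableAt kx.differentiableAt).symm

/-- By Leibniz, h·Dk has order (m + 1) + 0 and k·Dh has order 1 + m, so a further factor raises both
exponents by one. -/
theorem gradientOrderIdeal_mul_le (f : EuclideanSpace ℝ (Fin n) → ℝ) (hf : AnalyticAt ℝ f 0)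
    (m : ℕ) :
    gradientOrderIdeal f hf m * gradientOrderIdeal f hf 0 ≤ gradientOrderIdeal f hf (m + 1) := by
  rw [Ideal.mul_le]
  rintro a ⟨h, hh, e, h1, h2⟩ b ⟨k, hk, e', k1, k2⟩
  refine ⟨h * k, hh.mul hk, ?_, ?_, ?_⟩
  · rw [Germ.coe_mul, e, e']; rfl
  · exact (h1.mul k1).congr_right fun x => by ring
  · have h3 : (fun x => h x • fderiv ℝ k x) =O[𝓝 0] (fun x => ‖fderiv ℝ f x‖ ^ (m + 1)) :=
      (h1.smul k2).congr_right fun x => by simp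
    have h4 : (fun x => k x • fderiv ℝ h x) =O[𝓝 0] (fun x => ‖fderiv ℝ f x‖ ^ (m + 1)) :=
      (k1.smul h2).congr_right fun x => by simp [pow_succ']
    refine (h3.add h4).congr' ?_ EventuallyEq.rfl
    filter_upwards [hh.eventually_analyticAt, hk.eventually_analyticAt] with x hx kx
    exact (fderiv_mul hx.differentiableAt kx.differentiableAt).symm

theorem jacobiIdeal_le_gradientOrderIdeal (f : EuclideanSpace ℝ (Fin n) → ℝ)
    (hf : AnalyticAt ℝ f 0) : jacobiIdeal f hf ≤ gradientOrderIdeal f hf 0 := by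
  rw [jacobiIdeal, Ideal.span_le]
  rintro _ ⟨i, rfl⟩
  refine ⟨partialDeriv i f, analyticAt_partialDeriv i hf, rfl, ?_, ?_⟩
  · refine IsBigO.of_bound 1 (Eventually.of_forall fun x => ?_)
    simpa [partialDeriv] using (fderiv ℝ f x).le_opNorm (EuclideanSpace.single i 1)
  · simpa using (analyticAt_partialDeriv i hf).fderiv.continuousAt.isBigO_one ℝ

theorem jacobiIdeal_pow_le (f : EuclideanSpace ℝ (Fin n) → ℝ) (hf : AnalyticAt ℝ f 0) (m : ℕ) :
    jacobiIdeal f hf ^ (m + 1) ≤ gradientOrderIdeal f hf m := by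
  induction m with
  | zero => simpa using jacobiIdeal_le_gradientOrderIdeal f hf
  | succ m ih =>
    rw [pow_succ]
    exact (Ideal.mul_mono ih (jacobiIdeal_le_gradientOrderIdeal f hf)).trans
      (gradientOrderIdeal_mul_le f hf m)

theorem isBigO_of_mem_jacobiIdeal_pow {f h : EuclideanSpace ℝ (Fin n) → ℝ}
    (hf : AnalyticAt ℝ f 0) (hh : AnalyticAt ℝ h 0) {m : ℕ}
    (hmem : analyticGerm h hh ∈ jacobiIdeal f hf ^ (m + 1)) :
    h =O[𝓝 0] (fun x => ‖fderiv ℝ f x‖ ^ (m + 1)) ∧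
      fderiv ℝ h =O[𝓝 0] (fun x => ‖fderiv ℝ f x‖ ^ m) := by
  obtain ⟨k, -, e, k1, k2⟩ := jacobiIdeal_pow_le f hf m hmem
  have e' : k =ᶠ[𝓝 0] h := Germ.coe_eq.1 e
  exact ⟨k1.congr' e' EventuallyEq.rfl, k2.congr' e'.fderiv EventuallyEq.rfl⟩

/-! ### Gradient exponents and their lower bound 1/2 -/

theorem mem_lojasiewiczGradientExponents_iff {f : EuclideanSpace ℝ (Fin n) → ℝ} {η : ℝ} :
    η ∈ lojasiewiczGradientExponents f ↔
      0 < η ∧ (fun x => |f x| ^ η) =O[𝓝 0] fderiv ℝ f := by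
  refine and_congr_right fun hη => ⟨?_, fun h => ?_⟩
  · rintro ⟨C, hC, h⟩
    refine IsBigO.of_bound C⁻¹ (h.mono fun x hx => ?_)
    rw [norm_gradient_eq] at hx
    rw [Real.norm_of_nonneg (by positivity), inv_mul_eq_div, le_div_iff₀ hC]
    linarith
  · obtain ⟨C, hC, h⟩ := h.exists_pos
    refine ⟨C⁻¹, inv_pos.2 hC, h.bound.mono fun x hx => ?_⟩
    rw [Real.norm_of_nonneg (by positivity)] at hx
    rw [norm_gradient_eq, inv_mul_eq_div, div_le_iff₀ hC]
    linarith

theorem HasFPowerSeriesAt.coeff_one_apply {E : Type*} [NormedAddCommGroup E] [NormedSpace ℝ E]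
    {f : E → ℝ} {p : FormalMultilinearSeries ℝ E ℝ} (hp : HasFPowerSeriesAt f p 0)
    (v : E) : p 1 (fun _ => v) = fderiv ℝ f 0 v := by
  rw [hp.fderiv_eq]; rfl

/-- The leading homogeneous form of a nonzero analytic germ vanishing to second order. -/
theorem AnalyticAt.exists_leading_order {E : Type*} [NormedAddCommGroup E] [NormedSpace ℝ E]
    {f : E → ℝ} (hf : AnalyticAt ℝ f 0) (hf0 : f 0 = 0) (hdf0 : fderiv ℝ f 0 = 0)
    (hne : ¬ f =ᶠ[𝓝 0] 0) :
    ∃ k : ℕ, 2 ≤ k ∧ f =O[𝓝 0] (fun x => ‖x‖ ^ k) ∧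
      ∃ v : E, (fun t : ℝ => t ^ k) =O[𝓝 0] (fun t : ℝ => f (t • v)) := by
  classical
  obtain ⟨p, hp⟩ := hf
  have hex : ∃ k, ∃ v : E, p k (fun _ => v) ≠ 0 := by
    by_contra! h
    apply hne
    filter_upwards [hp.eventually_hasSum] with y hy
    simp only [h, zero_add] at hy
    exact hy.unique hasSum_zero
  -- The first index at which the series is nonzero on the diagonal; only diagonal values affect f.
  let k := Nat.find hex
  obtain ⟨v, hv⟩ : ∃ v : E, p k (fun _ => v) ≠ 0 := Nat.find_spec hex
  have hlt : ∀ j < k, ∀ v : E, p j (fun _ => v) = 0 := fun j hj v => by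
    by_contra h
    exact Nat.find_min hex hj ⟨v, h⟩
  have hsum : ∀ y, p.partialSum k y = 0 := fun y =>
    Finset.sum_eq_zero fun j hj => hlt j (Finset.mem_range.1 hj) y
  have hk2 : 2 ≤ k := by
    by_contra! h
    interval_cases hk : k
    · apply hv
      rw [hp.coeff_zero, hf0]
    · apply hv
      rw [HasFPowerSeriesAt.coeff_one_apply hp, hdf0]; rfl
  refine ⟨k, hk2, ?_, v, ?_⟩
  · simpa [hsum] using hp.isBigO_sub_partialSum_pow k
  · have h1 : (fun y => f y - p k (fun _ => y)) =O[𝓝 0] fun y => ‖y‖ ^ (k + 1) := by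
      have hsucc : ∀ y, p.partialSum (k + 1) y = p k (fun _ => y) := fun y => by
        rw [FormalMultilinearSeries.partialSum, Finset.sum_range_succ]
        exact (congrArg (· + _) (hsum y)).trans (zero_add _)
      simpa [hsucc] using
        hp.isBigO_sub_partialSum_pow (k + 1)
    have htend : Tendsto (fun t : ℝ => t • v) (𝓝 0) (𝓝 0) := by
      simpa using (tendsto_id (x := 𝓝 (0 : ℝ))).smul_const v
    have h2 : (fun t : ℝ => f (t • v) - t ^ k * p k (fun _ => v)) =o[𝓝 0]
        (fun t : ℝ => t ^ k * p k (fun _ => v)) := by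
      have := h1.comp_tendsto htend
      simp only [Function.comp_def, ContinuousMultilinearMap.map_smul_univ, Finset.prod_const,
        Finset.card_univ, Fintype.card_fin, smul_eq_mul, norm_smul, mul_pow] at this
      refine this.trans_isLittleO ?_
      have h3 : (fun t : ℝ => t ^ (k + 1)) =o[𝓝 0] (fun t : ℝ => t ^ k) :=
        isLittleO_pow_pow (Nat.lt_succ_self k)
      have h4 := ((h3.norm_left).const_mul_left (‖v‖ ^ (k + 1)))
      refine (h4.congr_left fun t => ?_).trans_isBigO
        (isBigO_self_const_mul hv (fun t : ℝ => t ^ k) (𝓝 0) |>.congr_right fun t => ?_)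
      · rw [norm_pow, mul_comm]
      · rw [mul_comm]
    have h5 := (isBigO_self_const_mul hv (fun t : ℝ => t ^ k) (𝓝 0)).congr_right
      (fun t => mul_comm _ _)
    exact h5.trans (h2.right_isBigO_add.congr_right fun t => by ring)

/-- An interpolation inequality of Landau type: if `f` is twice continuously differentiable
and `f = O(‖x‖ ^ k)`, then `Df = O(‖x‖ ^ (k / 2))`. -/
theorem AnalyticAt.fderiv_isBigO_rpow {E : Type*} [NormedAddCommGroup E] [NormedSpace ℝ E]
    {f : E → ℝ} (hf : AnalyticAt ℝ f 0) {k : ℕ} (hk : 2 ≤ k)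
    (hdf0 : fderiv ℝ f 0 = 0)
    (hfk : f =O[𝓝 0] (fun x => ‖x‖ ^ k)) :
    fderiv ℝ f =O[𝓝 0] (fun x => ‖x‖ ^ ((k : ℝ) / 2)) := by
  obtain ⟨C, hC, hfC⟩ := hfk.exists_pos
  obtain ⟨K, s, hs, hK⟩ :=
    (hf.fderiv.contDiffAt (n := 1)).exists_lipschitzOnWith
  obtain ⟨r, hr, hball⟩ := Metric.eventually_nhds_iff_ball.1
    (hfC.bound.and ((eventually_mem_set.2 hs).and hf.eventually_analyticAt))
  set B : ℝ := C * 2 ^ k + C + K with hB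
  have hB0 : 0 ≤ B := by positivity
  refine IsBigO.of_bound B ?_
  -- Radius 1 gives h ≤ ‖x‖ for the step h below; r / 2 then keeps the ball of radius h about x
  -- inside the ball of radius r.
  filter_upwards [Metric.ball_mem_nhds (0 : E) (ε := min (r / 2) 1) (by positivity)] with x hx
  rw [mem_ball_zero_iff, lt_min_iff] at hx
  obtain ⟨hx1, hx2⟩ := hx
  rw [Real.norm_of_nonneg (by positivity)]
  rcases (norm_nonneg x).eq_or_lt with h0 | h0
  · have : x = 0 := norm_eq_zero.1 h0.symm
    rw [this, hdf0, norm_zero]; positivity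
  -- This step length balances the difference quotient, of size ‖x‖^k / h, against the Taylor error
  -- K·h.
  set h : ℝ := ‖x‖ ^ ((k : ℝ) / 2) with hh
  have hpos : 0 < h := by positivity
  have hhx : h ≤ ‖x‖ := by
    have hk' : (1 : ℝ) ≤ k / 2 := by
      have : (2 : ℝ) ≤ k := by exact_mod_cast hk
      linarith
    simpa using Real.rpow_le_rpow_of_exponent_ge h0 hx2.le hk'
  have hsq : h * h = ‖x‖ ^ k := by
    rw [hh, ← Real.rpow_add h0, add_halves, Real.rpow_natCast]
  have hin : ∀ y ∈ Metric.closedBall x h, y ∈ Metric.ball (0 : E) r ∧ ‖y‖ ≤ 2 * ‖x‖ := by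
    intro y hy
    have : ‖y‖ ≤ 2 * ‖x‖ := by
      have h1 := norm_sub_norm_le y x
      rw [mem_closedBall_iff_norm] at hy
      linarith
    exact ⟨by rw [mem_ball_zero_iff]; linarith, this⟩
  have hxm : x ∈ Metric.closedBall x h := Metric.mem_closedBall_self hpos.le
  have hfx := (hball x (hin x hxm).1).1
  refine ContinuousLinearMap.opNorm_le_of_unit_norm (by positivity) fun v hv => ?_
  have hym : x + h • v ∈ Metric.closedBall x h := by
    simp [norm_smul, hv, abs_of_pos hpos]
  have hfy := (hball _ (hin _ hym).1).1
  have hmv := (convex_closedBall x h).norm_image_sub_le_of_norm_fderiv_le' (f := f) (𝕜 := ℝ)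
    (φ := fderiv ℝ f x) (C := K * h)
    (fun y hy => (hball y (hin y hy).1).2.2.differentiableAt)
    (fun y hy => (hK.norm_sub_le (hball y (hin y hy).1).2.1 (hball x (hin x hxm).1).2.1).trans
      (mul_le_mul_of_nonneg_left (mem_closedBall_iff_norm.1 hy) K.2)) hxm hym
  rw [add_sub_cancel_left, map_smul, norm_smul, hv, mul_one, smul_eq_mul,
    Real.norm_of_nonneg hpos.le] at hmv
  rw [norm_pow, norm_norm, ← hsq] at hfx
  have hyk : ‖x + h • v‖ ^ k ≤ 2 ^ k * (h * h) := by
    rw [hsq, ← mul_pow]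
    exact pow_le_pow_left₀ (norm_nonneg _) (hin _ hym).2 k
  rw [norm_pow, norm_norm] at hfy
  have hfy' := hfy.trans (mul_le_mul_of_nonneg_left hyk hC.le)
  have key : h * ‖fderiv ℝ f x v‖ ≤ h * (B * h) := by
    rw [← Real.norm_of_nonneg hpos.le, ← norm_mul, Real.norm_of_nonneg hpos.le]
    have : h * fderiv ℝ f x v = f (x + h • v) - f x - (f (x + h • v) - f x - h * fderiv ℝ f x v) :=
      by ring
    rw [this]
    refine (norm_sub_le _ _).trans ((add_le_add (norm_sub_le _ _) hmv).trans ?_)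
    rw [hB]
    linarith
  exact le_of_mul_le_mul_left key hpos

/-- Gradient exponents of a nonzero analytic germ with a critical zero at `0` are at least
`1 / 2`. -/
theorem half_le_of_mem_lojasiewiczGradientExponents {f : EuclideanSpace ℝ (Fin n) → ℝ}
    (hf : AnalyticAt ℝ f 0) (hf0 : f 0 = 0) (hdf0 : fderiv ℝ f 0 = 0) (hne : ¬ f =ᶠ[𝓝 0] 0)
    {η : ℝ} (hη : η ∈ lojasiewiczGradientExponents f) : 1 / 2 ≤ η := by
  obtain ⟨hη0, hO⟩ := mem_lojasiewiczGradientExponents_iff.1 hη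
  obtain ⟨k, hk, hfk, v, hv⟩ := hf.exists_leading_order hf0 hdf0 hne
  have hdf := hf.fderiv_isBigO_rpow hk hdf0 hfk
  have htend : Tendsto (fun t : ℝ => t • v) (𝓝[>] 0) (𝓝 0) := by
    have : Tendsto (fun t : ℝ => t • v) (𝓝 0) (𝓝 0) := by
      simpa using (tendsto_id (x := 𝓝 (0 : ℝ))).smul_const v
    exact this.mono_left nhdsWithin_le_nhds
  have h1 : (fun t : ℝ => (t ^ k) ^ η) =O[𝓝[>] 0] (fun t => |f (t • v)| ^ η) :=
    (hv.norm_right.mono nhdsWithin_le_nhds).rpow hη0.le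
      (Eventually.of_forall fun t => abs_nonneg _)
  have h2 := (h1.trans (hO.comp_tendsto htend)).trans (hdf.comp_tendsto htend)
  have h3 : (fun t : ℝ => t ^ ((k : ℝ) * η)) =O[𝓝[>] 0] (fun t : ℝ => t ^ ((k : ℝ) / 2)) := by
    have h4 : (fun t : ℝ => t ^ ((k : ℝ) * η)) =O[𝓝[>] 0]
        (fun t : ℝ => ‖v‖ ^ ((k : ℝ) / 2) * t ^ ((k : ℝ) / 2)) := by
      refine h2.congr' ?_ ?_ <;> filter_upwards [self_mem_nhdsWithin] with t ht
      · rw [Real.rpow_mul (le_of_lt ht), Real.rpow_natCast]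
      · simp only [Function.comp_apply]
        rw [norm_smul, Real.norm_of_nonneg (le_of_lt ht),
          Real.mul_rpow (le_of_lt ht) (norm_nonneg _), mul_comm]
    exact h4.trans (isBigO_const_mul_self _ _ _)
  -- If η < 1/2, dividing `h3` by t^(kη) bounds 1 by a positive power of t, which tends to 0.
  by_contra! hlt
  have hk0 : (0 : ℝ) < k := by exact_mod_cast (by omega : 0 < k)
  have hd : 0 < (k : ℝ) / 2 - k * η := by nlinarith
  have h5 : (fun _ : ℝ => (1 : ℝ)) =O[𝓝[>] 0] (fun t : ℝ => t ^ ((k : ℝ) / 2 - k * η)) := by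
    refine (h3.mul (isBigO_refl (fun t : ℝ => t ^ (-((k : ℝ) * η))) _)).congr' ?_ ?_ <;>
      filter_upwards [self_mem_nhdsWithin] with t ht
    · rw [← Real.rpow_add ht, add_neg_cancel, Real.rpow_zero]
    · rw [← Real.rpow_add ht, sub_eq_add_neg]
  have h6 : Tendsto (fun t : ℝ => t ^ ((k : ℝ) / 2 - k * η)) (𝓝[>] 0) (𝓝 0) := by
    have := (Real.continuousAt_rpow_const (0 : ℝ) _ (Or.inr hd.le)).tendsto
    rw [Real.zero_rpow hd.ne'] at this
    exact this.mono_left nhdsWithin_le_nhds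
  exact one_ne_zero (tendsto_nhds_unique tendsto_const_nhds (h5.trans_tendsto h6))

/-! ### Transfer of exponents between f and g -/

theorem lojasiewiczGradientExponents_subset {f g : EuclideanSpace ℝ (Fin n) → ℝ}
    (hf : AnalyticAt ℝ f 0) (hf0 : f 0 = 0) (hdf0 : fderiv ℝ f 0 = 0)
    (hgf : (g - f) =O[𝓝 0] (fun x => ‖fderiv ℝ f x‖ ^ 3))
    (hfg : fderiv ℝ f =O[𝓝 0] fderiv ℝ g) :
    lojasiewiczGradientExponents f ⊆ lojasiewiczGradientExponents g := by
  intro η hη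
  obtain ⟨hη0, hO⟩ := mem_lojasiewiczGradientExponents_iff.1 hη
  refine mem_lojasiewiczGradientExponents_iff.2 ⟨hη0, ?_⟩
  -- The bound 1/2 fails for the zero germ, but then g vanishes near 0 as well.
  by_cases hne : f =ᶠ[𝓝 0] 0
  · obtain ⟨C, hC⟩ := hgf.bound
    refine (isBigO_zero _ _).congr' ?_ EventuallyEq.rfl
    filter_upwards [hC, hne, hne.fderiv (𝕜 := ℝ)] with x hx h0 h1
    have : g x = 0 := by simpa [h1, h0] using hx
    simp [this, Real.zero_rpow hη0.ne']
  have hhalf := half_le_of_mem_lojasiewiczGradientExponents hf hf0 hdf0 hne hη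
  have hlim : Tendsto (fun x => ‖fderiv ℝ f x‖) (𝓝 0) (𝓝 0) := by
    simpa [hdf0] using hf.fderiv.continuousAt.norm.tendsto
  have h3 : (fun x => |(g - f) x| ^ η) =O[𝓝 0] fderiv ℝ f := by
    have h4 : (fun x => |(g - f) x| ^ η) =O[𝓝 0] (fun x => (‖fderiv ℝ f x‖ ^ 3) ^ η) :=
      hgf.norm_left.rpow hη0.le (Eventually.of_forall fun x => by positivity)
    refine h4.trans (IsBigO.of_bound 1 ?_)
    filter_upwards [hlim.eventually_le_const one_pos] with x hx
    rw [one_mul, Real.norm_of_nonneg (by positivity), ← Real.rpow_natCast,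
      ← Real.rpow_mul (norm_nonneg _)]
    exact Real.rpow_le_self_of_le_one (norm_nonneg _) hx (by push_cast; linarith)
  have hsum : (fun x => |g x| ^ η) =O[𝓝 0] (fun x => |f x| ^ η + |(g - f) x| ^ η) := by
    -- Bounding |g| by twice a maximum treats η < 1 and η ≥ 1 alike.
    refine IsBigO.of_bound (2 ^ η) (Eventually.of_forall fun x => ?_)
    rw [Real.norm_of_nonneg (by positivity), Real.norm_of_nonneg (by positivity)]
    have h1 : |g x| ≤ 2 * max |f x| |(g - f) x| := by
      have : |g x| ≤ |f x| + |(g - f) x| := by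
        simpa using abs_add_le (f x) ((g - f) x)
      linarith [le_max_left |f x| |(g - f) x|, le_max_right |f x| |(g - f) x|]
    refine (Real.rpow_le_rpow (abs_nonneg _) h1 hη0.le).trans ?_
    rw [Real.mul_rpow zero_le_two (by positivity)]
    gcongr
    rcases max_choice |f x| |(g - f) x| with h | h <;> rw [h]
    · exact le_add_of_nonneg_right (by positivity)
    · exact le_add_of_nonneg_left (by positivity)
  exact (hsum.trans (hO.add h3)).trans hfg

theorem mainTheorem5 (n : ℕ) (f g : EuclideanSpace ℝ (Fin n) → ℝ)
    (hf : AnalyticAt ℝ f 0) (hg : AnalyticAt ℝ g 0)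
    (hf0 : f 0 = 0) (hg0 : g 0 = 0)
    (hgrad : gradient f 0 = 0)
    (hgf : analyticGerm (g - f) (hg.sub hf) ∈ jacobiIdeal f hf ^ 3) :
    lojasiewiczGradientExponent f = lojasiewiczGradientExponent g ∧
      ∀ ρ : ℝ, IsLeast (lojasiewiczGradientExponents f) ρ ↔
        IsLeast (lojasiewiczGradientExponents g) ρ := by
  have hdf0 : fderiv ℝ f 0 = 0 := by
    rw [← norm_eq_zero, ← norm_gradient_eq, hgrad, norm_zero]
  obtain ⟨h1, h2⟩ := isBigO_of_mem_jacobiIdeal_pow hf (hg.sub hf) (m := 2) hgf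
  have hlim : Tendsto (fun x => ‖fderiv ℝ f x‖) (𝓝 0) (𝓝 0) := by
    simpa [hdf0] using hf.fderiv.continuousAt.norm.tendsto
  have hsub : (fun x => fderiv ℝ g x - fderiv ℝ f x) =o[𝓝 0] fderiv ℝ f := by
    have h3 : (fun x => ‖fderiv ℝ f x‖ ^ 2) =o[𝓝 0] fderiv ℝ f := by
      refine isLittleO_norm_right.1 ?_
      simpa [sq] using ((isLittleO_one_iff ℝ).2 hlim).mul_isBigO
        (isBigO_refl (fun x => ‖fderiv ℝ f x‖) (𝓝 0))
    refine (h2.trans_isLittleO h3).congr' ?_ EventuallyEq.rfl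
    filter_upwards [hf.eventually_analyticAt, hg.eventually_analyticAt] with x hx kx
    exact fderiv_sub kx.differentiableAt hx.differentiableAt
  have hfg : fderiv ℝ f =O[𝓝 0] fderiv ℝ g :=
    hsub.right_isBigO_add.congr_right fun x => sub_add_cancel _ _
  have hgf' : fderiv ℝ g =O[𝓝 0] fderiv ℝ f :=
    (hsub.isBigO.add (isBigO_refl _ _)).congr_left fun x => sub_add_cancel _ _
  have hdg0 : fderiv ℝ g 0 = 0 := by
    obtain ⟨C, hC⟩ := hgf'.bound
    simpa [hdf0] using hC.self_of_nhds
  -- The reverse inclusion needs only this growth bound, not membership in the Jacobi ideal of g.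
  have h4 : (f - g) =O[𝓝 0] (fun x => ‖fderiv ℝ g x‖ ^ 3) :=
    (h1.neg_left.congr_left fun x => by simp).trans (hfg.norm_norm.pow 3)
  have hS : lojasiewiczGradientExponents f = lojasiewiczGradientExponents g :=
    (lojasiewiczGradientExponents_subset hf hf0 hdf0 h1 hfg).antisymm
      (lojasiewiczGradientExponents_subset hg hg0 hdg0 h4 hgf')
  refine ⟨?_, fun ρ => by rw [hS]⟩
  rw [lojasiewiczGradientExponent, lojasiewiczGradientExponent, hS]
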